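/- Let $n\ge 0$ and $[n]=\{1,\dots,n\}$. For $w\in S_n$ let $E_{val}(w)=\{w(i) : i\in[n],\ i\le w(i)\}$ and $E_{pos}(w)=\{i\in[n] : i\le w(i)\}$ be the sets of weak excedance values and weak excedance positions of $w$. Write $v\sim w$ if $E_{val}(v)=E_{val}(w)$ and $E_{pos}(v)=E_{pos}(w)$; the equivalence classes of $\sim$ on $S_n$ are called excedance classes. The Bruhat order on $S_n$ is the partial order generated by the relations $v<w$ whenever $wv^{-1}$ is a transposition and $\ell(v)<\ell(w)$, where $\ell$ is the number of inversions. It induces the following relation on excedance classes: $\mathcal A\le\mathcal B$ if and only if $v\le w$ in the Bruhat order for some $v\in\mathcal A$ and some $w\in\mathcal B$. A noncrossing partition of size $n$ is a set $\lambda$ of arcs $(i,j)$ with $1\le i<j\le n$ that contains no two distinct arcs $(i,k)$, $(j,l)$ with $i\le j<k\le l$. Let $\lambda^{+}$ be the set of left endpoints and $\lambda^{-}$ the set of right endpoints of the arcs of $\lambda$, and put $$\mathcal C_\lambda=\{w\in S_n : E_{val}(w)=[n]\setminus\lambda^{+},\ E_{pos}(w)=[n]\setminus\lambda^{-}\}.$$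 Let $\preceq$ be the reflexive transitive closure, on the set of noncrossing partitions of size $n$, of the following relation: $\lambda$ is covered by $\mu$ if the noncrossing partition $\lambda$ is obtained from $\mu$ either by removing an arc of the form $(i,i+1)$, or by replacing an arc $(i,k)$ by two arcs $(i,j)$ and $(j,k)$ for some $i<j<k$, where the new arcs neither cross nor share a left or right endpoint with any other arc of $\mu$. Then $\lambda\mapsto\mathcal C_\lambda$ is a bijection from the set of noncrossing partitions of size $n$ onto the set of excedance classes of $S_n$. For all noncrossing partitions $\lambda,\mu$ of size $n$, $$\mathcal C_\lambda\le\mathcal C_\mu\quad\text{if and only if}\quad\lambda\preceq\mu.$$ In particular, the induced relation $\le$ is a partial order on the set of excedance classes. -/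

import Mathlib

/-- A noncrossing partition of size `n`: a set of arcs `(i, j)` with `i < j` on the points of
`Fin n` (the points `1, …, n` of the diagram, shifted to `0, …, n - 1`), containing no two distinct
arcs `(i, k)` and `(j, l)` with `i ≤ j < k ≤ l`. -/
@[ext]
structure NCP (n : ℕ) where
  arcs : Finset (Fin n × Fin n)
  lt_of_mem : ∀ a ∈ arcs, a.1 < a.2
  noncrossing : ∀ a ∈ arcs, ∀ b ∈ arcs, a ≠ b → ¬ (a.1 ≤ b.1 ∧ b.1 < a.2 ∧ a.2 ≤ b.2)

namespace NCP

variable {n : ℕ}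

/-- The set of left endpoints of the arcs. -/
def leftEnds (lam : NCP n) : Set (Fin n) := {i | ∃ j, (i, j) ∈ lam.arcs}

/-- The set of right endpoints of the arcs. -/
def rightEnds (lam : NCP n) : Set (Fin n) := {j | ∃ i, (i, j) ∈ lam.arcs}

/-- `lam` is obtained from `mu` by removing an arc joining two consecutive points. -/
def RemovesShortArc (lam mu : NCP n) : Prop :=
  ∃ i j : Fin n, (j : ℕ) = (i : ℕ) + 1 ∧ (i, j) ∈ mu.arcs ∧ lam.arcs = mu.arcs.erase (i, j)

/-- `lam` is obtained from `mu` by replacing an arc `(i, k)` by `(i, j)` and `(j, k)`, where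
`i < j < k`. That the new arcs neither cross the other arcs of `mu` nor share a left or a right
endpoint with them is the requirement that `lam` is again a noncrossing partition. -/
def SplitsArc (lam mu : NCP n) : Prop :=
  ∃ i j k : Fin n, i < j ∧ j < k ∧ (i, k) ∈ mu.arcs ∧
    lam.arcs = insert (i, j) (insert (j, k) (mu.arcs.erase (i, k)))

/-- The covering relation: `lam` is covered by `mu`. -/
def CoveredBy (lam mu : NCP n) : Prop := RemovesShortArc lam mu ∨ SplitsArc lam mu

/-- The order `lam ⪯ mu`: the reflexive transitive closure of the covering relation. -/
def Prec (lam mu : NCP n) : Prop := Relation.ReflTransGen CoveredBy lam mu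

end NCP

namespace ExcedanceQuotient

variable {n : ℕ}

/-- The length of a permutation: its number of inversions. -/
def length (w : Equiv.Perm (Fin n)) : ℕ :=
  (Finset.univ.filter (fun p : Fin n × Fin n => p.1 < p.2 ∧ w p.2 < w p.1)).card

/-- The generating relation of the Bruhat order. -/
def BruhatStep (v w : Equiv.Perm (Fin n)) : Prop :=
  (w * v⁻¹).IsSwap ∧ length v < length w

/-- The Bruhat order on the symmetric group. -/
def BruhatLE (v w : Equiv.Perm (Fin n)) : Prop := Relation.ReflTransGen BruhatStep v w

/-- The set of weak excedance values of `w`. -/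
def excVal (w : Equiv.Perm (Fin n)) : Set (Fin n) := {x | ∃ i, i ≤ w i ∧ w i = x}

/-- The set of weak excedance positions of `w`. -/
def excPos (w : Equiv.Perm (Fin n)) : Set (Fin n) := {i | i ≤ w i}

/-- The excedance relation on the symmetric group. -/
def excSetoid (n : ℕ) : Setoid (Equiv.Perm (Fin n)) where
  r v w := excVal v = excVal w ∧ excPos v = excPos w
  iseqv :=
    { refl := fun _ => ⟨rfl, rfl⟩
      symm := fun h => ⟨h.1.symm, h.2.symm⟩
      trans := fun h h' => ⟨h.1.trans h'.1, h.2.trans h'.2⟩ }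

/-- The set of permutations attached to a noncrossing partition: weak excedance values are the
points that are not left endpoints, weak excedance positions those that are not right endpoints. -/
def excClass (lam : NCP n) : Set (Equiv.Perm (Fin n)) :=
  {w | excVal w = lam.leftEndsᶜ ∧ excPos w = lam.rightEndsᶜ}

/-- The relation on sets of permutations (in particular on excedance classes) induced by the
Bruhat order: some element of `A` lies below some element of `B`. -/
def ClassLE (A B : Set (Equiv.Perm (Fin n))) : Prop := ∃ v ∈ A, ∃ w ∈ B, BruhatLE v w

end ExcedanceQuotient

/-!
Counting the arcs open at each half step turns a noncrossing partition into a lattice path that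
determines it, and `⪯` is the pointwise order of these paths: a cover lowers the path by one at a
single time, and if one path lies below another, the upper one can be lowered by a cover at a time
where it is highest among the times with a strict gap.

The arcs `(w r, r)` with `w r < r` form a possibly crossing diagram with the same endpoints as the
noncrossing partition of the class of `w`, hence with the same path. Its heights are numbers of
points `r` with `r ≥ k` and `w r < m`, which can only grow in the Bruhat order. Conversely a cover
lifts to a Bruhat step between permutations whose diagrams are the two noncrossing partitions. Every
class is hit, since exchanging the values at two crossing arcs produces a longer permutation in the
same class, so that the diagram of a longest element is noncrossing.
-/

namespace NCP

open scoped Finset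

variable {n : ℕ}

/-- The arc `a` crosses `b`, or shares a left or a right endpoint with it, with `a` to the left:
the configuration excluded in a noncrossing partition. -/
def Crosses (a b : Fin n × Fin n) : Prop := a.1 ≤ b.1 ∧ b.1 < a.2 ∧ a.2 ≤ b.2

theorem pairwise_not_crosses (lam : NCP n) :
    (lam.arcs : Set (Fin n × Fin n)).Pairwise fun a b => ¬ Crosses a b :=
  fun a ha b hb => lam.noncrossing a ha b hb

/-- The arc diagram of a set partition, crossing or not: arcs go from left to right and have
distinct left endpoints and distinct right endpoints. -/
structure IsDiagram (S : Finset (Fin n × Fin n)) : Prop where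
  lt : ∀ a ∈ S, a.1 < a.2
  injOn_fst : Set.InjOn Prod.fst (S : Set (Fin n × Fin n))
  injOn_snd : Set.InjOn Prod.snd (S : Set (Fin n × Fin n))

theorem isDiagram (lam : NCP n) : IsDiagram lam.arcs where
  lt := lam.lt_of_mem
  injOn_fst a ha b hb hab := by
    by_contra hne
    have hac := lam.pairwise_not_crosses ha hb hne
    have hca := lam.pairwise_not_crosses hb ha (Ne.symm hne)
    have := lam.lt_of_mem a ha
    have := lam.lt_of_mem b hb
    grind [Crosses]
  injOn_snd a ha b hb hab := by
    by_contra hne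
    have hac := lam.pairwise_not_crosses ha hb hne
    have hca := lam.pairwise_not_crosses hb ha (Ne.symm hne)
    have := lam.lt_of_mem a ha
    have := lam.lt_of_mem b hb
    grind [Crosses]

theorem IsDiagram.left_unique {S : Finset (Fin n × Fin n)} (hS : IsDiagram S) {i j k : Fin n}
    (hi : (i, k) ∈ S) (hj : (j, k) ∈ S) : i = j :=
  congrArg Prod.fst (hS.injOn_snd hi hj rfl)

theorem IsDiagram.right_unique {S : Finset (Fin n × Fin n)} (hS : IsDiagram S) {i j k : Fin n}
    (hj : (i, j) ∈ S) (hk : (i, k) ∈ S) : j = k :=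
  congrArg Prod.snd (hS.injOn_fst hj hk rfl)

theorem coe_image_fst_arcs (lam : NCP n) : ↑(lam.arcs.image Prod.fst) = lam.leftEnds := by
  ext i; simp [leftEnds]

theorem coe_image_snd_arcs (lam : NCP n) : ↑(lam.arcs.image Prod.snd) = lam.rightEnds := by
  ext i; simp [rightEnds]

/-- By induction on `j - i`: the arcs of `mu` starting in `i` and ending in `j` are not shorter than
`(i, j)`, so they cross unless both are `(i, j)`. -/
theorem mem_arcs_of_ends_eq {lam mu : NCP n} (hl : lam.leftEnds = mu.leftEnds)
    (hr : lam.rightEnds = mu.rightEnds) {i j : Fin n} (hij : (i, j) ∈ lam.arcs) :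
    (i, j) ∈ mu.arcs := by
  induction hd : (j : ℕ) - i using Nat.strong_induction_on generalizing lam mu i j with
  | _ d ih =>
    subst hd
    obtain ⟨k, hik⟩ : i ∈ mu.leftEnds := hl ▸ ⟨j, hij⟩
    obtain ⟨p, hpj⟩ : j ∈ mu.rightEnds := hr ▸ ⟨i, hij⟩
    have hlt := lam.lt_of_mem _ hij
    have hlt_k := mu.lt_of_mem _ hik
    have hlt_p := mu.lt_of_mem _ hpj
    have hjk : j ≤ k := by
      by_contra! hkj
      have hik' : (i, k) ∈ lam.arcs := ih _ (by grind) hl.symm hr.symm hik rfl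
      exact hkj.ne (lam.isDiagram.right_unique hik' hij)
    have hpi : p ≤ i := by
      by_contra! hip
      have hpj' : (p, j) ∈ lam.arcs := ih _ (by grind) hl.symm hr.symm hpj rfl
      exact hip.ne (lam.isDiagram.left_unique hij hpj')
    by_contra hnot
    exact mu.pairwise_not_crosses hpj hik (by grind) ⟨hpi, hlt, hjk⟩

theorem ext_of_ends {lam mu : NCP n} (hl : lam.leftEnds = mu.leftEnds)
    (hr : lam.rightEnds = mu.rightEnds) : lam = mu :=
  NCP.ext (Finset.ext fun _ =>
    ⟨mem_arcs_of_ends_eq hl hr, mem_arcs_of_ends_eq hl.symm hr.symm⟩)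

/-- The lattice path of a set of arcs, with two steps for each point: at time `2 * i` the arc
ending in `i` is still open, at time `2 * i + 1` it is closed, and at time `2 * i + 2` the arc
starting in `i` is open. The height is the number of open arcs. -/
def height (S : Finset (Fin n × Fin n)) (t : ℕ) : ℕ :=
  #{a ∈ S | 2 * (a.1 : ℕ) + 2 ≤ t ∧ t ≤ 2 * (a.2 : ℕ)}

theorem height_insert {S : Finset (Fin n × Fin n)} {a : Fin n × Fin n} (ha : a ∉ S) (t : ℕ) :
    height (insert a S) t =
      height S t + if 2 * (a.1 : ℕ) + 2 ≤ t ∧ t ≤ 2 * (a.2 : ℕ) then 1 else 0 := by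
  simp only [height, Finset.card_filter, Finset.sum_insert ha, add_comm]

theorem height_erase {S : Finset (Fin n × Fin n)} {a : Fin n × Fin n} (ha : a ∈ S) (t : ℕ) :
    height S t =
      height (S.erase a) t + if 2 * (a.1 : ℕ) + 2 ≤ t ∧ t ≤ 2 * (a.2 : ℕ) then 1 else 0 := by
  rw [← height_insert (Finset.notMem_erase a S), Finset.insert_erase ha]

theorem height_pos_iff {S : Finset (Fin n × Fin n)} {t : ℕ} :
    0 < height S t ↔ ∃ a ∈ S, 2 * (a.1 : ℕ) + 2 ≤ t ∧ t ≤ 2 * (a.2 : ℕ) := by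
  simp [height, Finset.card_pos, Finset.filter_nonempty_iff]

theorem card_filter_lt_eq_count {α : Type*} {S : Finset α} {f : α → ℕ}
    (hf : Set.InjOn f (S : Set α)) (m : ℕ) :
    #{a ∈ S | f a < m} = Nat.count (· ∈ S.image f) m := by
  have himage : {k ∈ Finset.range m | k ∈ S.image f} = ({a ∈ S | f a < m}).image f := by
    ext k
    simp only [Finset.mem_filter, Finset.mem_range, Finset.mem_image]
    grind
  rw [Nat.count_eq_card_filter_range, himage, Finset.card_image_of_injOn]
  exact hf.mono (Finset.coe_subset.2 (Finset.filter_subset _ _))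

/-- The open arcs are those already started but not yet ended. -/
theorem IsDiagram.height_add_count {S : Finset (Fin n × Fin n)} (hS : IsDiagram S) (t : ℕ) :
    height S t + Nat.count (· ∈ (S.image Prod.snd).image Fin.val) ((t + 1) / 2) =
      Nat.count (· ∈ (S.image Prod.fst).image Fin.val) (t / 2) := by
  rw [Finset.image_image, Finset.image_image,
    ← card_filter_lt_eq_count (Fin.val_injective.comp_injOn hS.injOn_fst),
    ← card_filter_lt_eq_count (Fin.val_injective.comp_injOn hS.injOn_snd), height,
    ← Finset.card_union_of_disjoint]
  · congr 1
    ext a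
    have := hS.lt a
    grind
  · rw [Finset.disjoint_filter]
    grind

theorem IsDiagram.height_congr {S T : Finset (Fin n × Fin n)} (hS : IsDiagram S)
    (hT : IsDiagram T) (hfst : S.image Prod.fst = T.image Prod.fst)
    (hsnd : S.image Prod.snd = T.image Prod.snd) : height S = height T := by
  ext t
  have hS_count := hS.height_add_count t
  have hT_count := hT.height_add_count t
  rw [hfst, hsnd] at hS_count
  omega

theorem IsDiagram.height_two_mul {S : Finset (Fin n × Fin n)} (hS : IsDiagram S) (i : Fin n) :
    height S (2 * i) = height S (2 * i + 1) + if i ∈ S.image Prod.snd then 1 else 0 := by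
  have hbefore := hS.height_add_count (2 * i)
  have hafter := hS.height_add_count (2 * i + 1)
  have hcount := Nat.count_succ (· ∈ (S.image Prod.snd).image Fin.val) i
  simp only [Fin.val_injective.mem_finset_image] at hcount
  rw [show (2 * (i : ℕ) + 1) / 2 = i by omega, show 2 * (i : ℕ) / 2 = i by omega] at hbefore
  rw [show (2 * (i : ℕ) + 1 + 1) / 2 = i + 1 by omega, show (2 * (i : ℕ) + 1) / 2 = i by omega,
    hcount] at hafter
  omega

theorem IsDiagram.height_two_mul_add_two {S : Finset (Fin n × Fin n)} (hS : IsDiagram S)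
    (i : Fin n) :
    height S (2 * i + 2) = height S (2 * i + 1) + if i ∈ S.image Prod.fst then 1 else 0 := by
  have hbefore := hS.height_add_count (2 * i + 1)
  have hafter := hS.height_add_count (2 * i + 2)
  have hcount := Nat.count_succ (· ∈ (S.image Prod.fst).image Fin.val) i
  simp only [Fin.val_injective.mem_finset_image] at hcount
  rw [show (2 * (i : ℕ) + 1 + 1) / 2 = i + 1 by omega,
    show (2 * (i : ℕ) + 1) / 2 = i by omega] at hbefore
  rw [show (2 * (i : ℕ) + 2 + 1) / 2 = i + 1 by omega,
    show (2 * (i : ℕ) + 2) / 2 = i + 1 by omega, hcount] at hafter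
  omega

theorem IsDiagram.image_eq_of_height_eq {S T : Finset (Fin n × Fin n)} (hS : IsDiagram S)
    (hT : IsDiagram T) (h : height S = height T) :
    S.image Prod.fst = T.image Prod.fst ∧ S.image Prod.snd = T.image Prod.snd := by
  refine ⟨Finset.ext fun i => ?_, Finset.ext fun i => ?_⟩
  · have hS_step := hS.height_two_mul_add_two i
    have hT_step := hT.height_two_mul_add_two i
    rw [h, hT_step] at hS_step
    grind
  · have hS_step := hS.height_two_mul i
    have hT_step := hT.height_two_mul i
    rw [h, hT_step] at hS_step
    grind

theorem height_arcs_injective : Function.Injective fun lam : NCP n => height lam.arcs := by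
  intro lam mu h
  obtain ⟨hfst, hsnd⟩ := lam.isDiagram.image_eq_of_height_eq mu.isDiagram h
  apply ext_of_ends
  · rw [← coe_image_fst_arcs, hfst, coe_image_fst_arcs]
  · rw [← coe_image_snd_arcs, hsnd, coe_image_snd_arcs]

/-- Noncrossing partitions are ordered by the pointwise order of their lattice paths. -/
instance : PartialOrder (NCP n) :=
  PartialOrder.lift (fun lam => height lam.arcs) height_arcs_injective

theorem le_def {lam mu : NCP n} : lam ≤ mu ↔ ∀ t, height lam.arcs t ≤ height mu.arcs t :=
  Iff.rfl

instance : Finite (NCP n) :=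
  Finite.of_injective NCP.arcs fun _ _ => NCP.ext

section Covers

variable {lam mu : NCP n} {i j k : Fin n}

theorem height_of_erase_short (hij : (j : ℕ) = i + 1) (hmem : (i, j) ∈ mu.arcs)
    (h : lam.arcs = mu.arcs.erase (i, j)) :
    height mu.arcs = height lam.arcs + Pi.single (2 * (j : ℕ)) 1 := by
  ext t
  rw [height_erase hmem, ← h, Pi.add_apply, Pi.single_apply]
  grind

theorem height_of_split (hij : i < j) (hjk : j < k) (hmem : (i, k) ∈ mu.arcs)
    (h : lam.arcs = insert (i, j) (insert (j, k) (mu.arcs.erase (i, k)))) :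
    height mu.arcs = height lam.arcs + Pi.single (2 * (j : ℕ) + 1) 1 := by
  have hjk_new : (j, k) ∉ mu.arcs.erase (i, k) := fun hjk_mem =>
    hij.ne (mu.isDiagram.left_unique hmem (Finset.mem_of_mem_erase hjk_mem))
  have hij_new : (i, j) ∉ insert (j, k) (mu.arcs.erase (i, k)) := by
    rw [Finset.mem_insert, Finset.mem_erase, Prod.mk.injEq]
    rintro (⟨rfl, -⟩ | ⟨-, hij_mem⟩)
    · exact hij.false
    · exact hjk.ne (mu.isDiagram.right_unique hij_mem hmem)
  ext t
  rw [height_erase hmem, Pi.add_apply, h, height_insert hij_new, height_insert hjk_new,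
    Pi.single_apply]
  grind

theorem CoveredBy.lt (h : CoveredBy lam mu) : lam < mu := by
  obtain ⟨t, ht⟩ : ∃ t, height mu.arcs = height lam.arcs + Pi.single t 1 := by
    rcases h with ⟨i, j, hij, hmem, h⟩ | ⟨i, j, k, hij, hjk, hmem, h⟩
    · exact ⟨_, height_of_erase_short hij hmem h⟩
    · exact ⟨_, height_of_split hij hjk hmem h⟩
  change height lam.arcs < height mu.arcs
  rw [ht]
  exact lt_add_of_pos_right _ (Pi.single_pos.2 one_pos)

theorem mem_arcs_of_consecutive (hij : (j : ℕ) = i + 1) (hi : i ∈ mu.arcs.image Prod.fst)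
    (hj : j ∈ mu.arcs.image Prod.snd) : (i, j) ∈ mu.arcs := by
  simp only [Finset.mem_image, Prod.exists, exists_and_right, exists_eq_right] at hi hj
  obtain ⟨k, hik⟩ := hi
  obtain ⟨p, hpj⟩ := hj
  have hlt_k := mu.lt_of_mem _ hik
  have hlt_p := mu.lt_of_mem _ hpj
  by_contra hnot
  exact mu.pairwise_not_crosses hpj hik (by grind) (by grind [Crosses])

/-- The noncrossing partition with the arc `a` removed. -/
def eraseArc (mu : NCP n) (a : Fin n × Fin n) : NCP n where
  arcs := mu.arcs.erase a
  lt_of_mem b hb := mu.lt_of_mem b (Finset.mem_of_mem_erase hb)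
  noncrossing b hb c hc :=
    mu.noncrossing b (Finset.mem_of_mem_erase hb) c (Finset.mem_of_mem_erase hc)

theorem exists_innermost_arc {S : Finset (Fin n × Fin n)} (hpos : 0 < height S (2 * j + 1)) :
    ∃ i k, (i, k) ∈ S ∧ i < j ∧ j < k ∧ ∀ a ∈ S, a.1 < j → j < a.2 → a.1 ≤ i := by
  obtain ⟨⟨i, k⟩, hik, hmax⟩ :=
    Finset.exists_max_image _ (fun a : Fin n × Fin n => a.1) (Finset.card_pos.1 hpos)
  simp only [Finset.mem_filter] at hik hmax
  exact ⟨i, k, hik.1, by grind, by grind, fun a ha haj hja => hmax a ⟨ha, by grind⟩⟩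

/-- Splitting the innermost arc over `j` creates no crossing: an arc crossing a new arc either
crosses the old one or also passes over `j`. -/
theorem pairwise_not_crosses_split (hik : (i, k) ∈ mu.arcs) (hij : i < j) (hjk : j < k)
    (hfst : j ∉ mu.arcs.image Prod.fst) (hsnd : j ∉ mu.arcs.image Prod.snd)
    (hinner : ∀ a ∈ mu.arcs, a.1 < j → j < a.2 → a.1 ≤ i) :
    (insert (i, j) (insert (j, k) (mu.arcs.erase (i, k))) : Set (Fin n × Fin n)).Pairwise
      fun a b => ¬ Crosses a b := by
  have hold : ∀ a ∈ mu.arcs.erase (i, k), ¬ Crosses a (i, k) ∧ ¬ Crosses (i, k) a ∧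
      a.1 ≠ j ∧ a.2 ≠ j ∧ (a.1 < j → j < a.2 → a.1 ≤ i) := by
    intro a ha
    obtain ⟨hne, ha⟩ := Finset.mem_erase.1 ha
    exact ⟨mu.pairwise_not_crosses ha hik hne, mu.pairwise_not_crosses hik ha hne.symm,
      fun h => hfst (h ▸ Finset.mem_image_of_mem _ ha),
      fun h => hsnd (h ▸ Finset.mem_image_of_mem _ ha), hinner a ha⟩
  rw [Set.pairwise_insert, Set.pairwise_insert]
  refine ⟨⟨(mu.eraseArc (i, k)).pairwise_not_crosses, fun a ha _ => ?_⟩, ?_⟩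
  · have := hold a ha
    grind [Crosses]
  · rintro a (rfl | ha) -
    · grind [Crosses]
    · have := hold a ha
      grind [Crosses]

theorem exists_split (hfst : j ∉ mu.arcs.image Prod.fst) (hsnd : j ∉ mu.arcs.image Prod.snd)
    (hpos : 0 < height mu.arcs (2 * j + 1)) :
    ∃ (nu : NCP n) (i k : Fin n), i < j ∧ j < k ∧ (i, k) ∈ mu.arcs ∧
      nu.arcs = insert (i, j) (insert (j, k) (mu.arcs.erase (i, k))) := by
  obtain ⟨i, k, hik, hij, hjk, hinner⟩ := exists_innermost_arc hpos
  refine ⟨⟨insert (i, j) (insert (j, k) (mu.arcs.erase (i, k))), ?_, fun a ha b hb => ?_⟩,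
    i, k, hij, hjk, hik, rfl⟩
  · have := mu.lt_of_mem
    grind
  · exact pairwise_not_crosses_split hik hij hjk hfst hsnd hinner (by exact_mod_cast ha)
      (by exact_mod_cast hb)

theorem exists_coveredBy_of_peak (hij : (j : ℕ) = i + 1) (hi : i ∈ mu.arcs.image Prod.fst)
    (hj : j ∈ mu.arcs.image Prod.snd) :
    ∃ nu, CoveredBy nu mu ∧ height mu.arcs = height nu.arcs + Pi.single (2 * (j : ℕ)) 1 := by
  have hmem := mem_arcs_of_consecutive hij hi hj
  exact ⟨mu.eraseArc (i, j), Or.inl ⟨i, j, hij, hmem, rfl⟩, height_of_erase_short hij hmem rfl⟩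

theorem exists_coveredBy_of_plateau (hfst : j ∉ mu.arcs.image Prod.fst)
    (hsnd : j ∉ mu.arcs.image Prod.snd) (hpos : 0 < height mu.arcs (2 * j + 1)) :
    ∃ nu, CoveredBy nu mu ∧ height mu.arcs = height nu.arcs + Pi.single (2 * (j : ℕ) + 1) 1 := by
  obtain ⟨nu, i, k, hij, hjk, hik, hnu⟩ := exists_split hfst hsnd hpos
  exact ⟨nu, Or.inr ⟨i, j, k, hij, hjk, hik, hnu⟩, height_of_split hij hjk hik hnu⟩

/-- The parity breaks ties between times at which `g` is equally high, in favour of the odd ones. -/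
theorem exists_highest_gap {f g : ℕ → ℕ} {N : ℕ} (hg : ∀ t, N ≤ t → g t = 0) (hfg : f < g) :
    ∃ t, f t < g t ∧ ∀ s, f s < g s → 2 * g s + s % 2 ≤ 2 * g t + t % 2 := by
  obtain ⟨-, t₀, ht₀⟩ := Pi.lt_def.1 hfg
  have hlt_N : ∀ t, f t < g t → t < N := fun t ht => by
    by_contra! hN
    have := hg t hN
    omega
  obtain ⟨t, ht, hmax⟩ := Finset.exists_max_image {t ∈ Finset.range N | f t < g t}
    (fun t => 2 * g t + t % 2) ⟨t₀, by grind⟩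
  exact ⟨t, (Finset.mem_filter.1 ht).2, fun s hs => hmax s (by grind)⟩

/-- The upper path has a peak at `t` if `t` is even and a plateau if `t` is odd: otherwise some
neighbouring time would have a higher gap, or an equally high gap at an odd time. -/
theorem exists_coveredBy_of_highest_gap {t : ℕ} (ht : height lam.arcs t < height mu.arcs t)
    (hmax : ∀ s, height lam.arcs s < height mu.arcs s →
      2 * height mu.arcs s + s % 2 ≤ 2 * height mu.arcs t + t % 2) :
    ∃ nu, CoveredBy nu mu ∧ height mu.arcs = height nu.arcs + Pi.single t 1 := by
  obtain ⟨a, -, hat⟩ := height_pos_iff.1 (Nat.zero_lt_of_lt ht)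
  obtain ⟨m, rfl | rfl⟩ := Nat.even_or_odd' t
  · let i : Fin n := ⟨m - 1, by omega⟩
    let j : Fin n := ⟨m, by omega⟩
    have hi : i ∈ mu.arcs.image Prod.fst := by
      have hlam := lam.isDiagram.height_two_mul_add_two i
      have hmu := mu.isDiagram.height_two_mul_add_two i
      have := hmax (2 * i + 1)
      grind
    have hj : j ∈ mu.arcs.image Prod.snd := by
      have hlam := lam.isDiagram.height_two_mul j
      have hmu := mu.isDiagram.height_two_mul j
      have := hmax (2 * j + 1)
      grind
    exact exists_coveredBy_of_peak (by grind) hi hj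
  · let j : Fin n := ⟨m, by omega⟩
    have hj_fst : j ∉ mu.arcs.image Prod.fst := by
      have hlam := lam.isDiagram.height_two_mul_add_two j
      have hmu := mu.isDiagram.height_two_mul_add_two j
      have := hmax (2 * j + 2)
      grind
    have hj_snd : j ∉ mu.arcs.image Prod.snd := by
      have hlam := lam.isDiagram.height_two_mul j
      have hmu := mu.isDiagram.height_two_mul j
      have := hmax (2 * j)
      grind
    exact exists_coveredBy_of_plateau hj_fst hj_snd (Nat.zero_lt_of_lt ht)

theorem exists_coveredBy_of_lt (h : lam < mu) : ∃ nu, CoveredBy nu mu ∧ lam ≤ nu := by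
  have hzero : ∀ t, 2 * n ≤ t → height mu.arcs t = 0 := fun t ht => by
    by_contra hne
    obtain ⟨a, -, ha⟩ := height_pos_iff.1 (Nat.pos_of_ne_zero hne)
    omega
  obtain ⟨t, ht, hmax⟩ := exists_highest_gap hzero h
  obtain ⟨nu, hnu, hheight⟩ := exists_coveredBy_of_highest_gap ht hmax
  refine ⟨nu, hnu, le_def.2 fun s => ?_⟩
  have hle := le_def.1 h.le s
  have hs := congrFun hheight s
  rw [Pi.add_apply, Pi.single_apply] at hs
  grind

theorem prec_iff_le : Prec lam mu ↔ lam ≤ mu := by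
  refine ⟨fun h => ?_, fun h => ?_⟩
  · induction h with
    | refl => exact le_rfl
    | tail _ hcov ih => exact ih.trans hcov.lt.le
  · induction mu using WellFoundedLT.induction with
    | _ mu ih =>
      obtain rfl | hlt := h.eq_or_lt
      · exact Relation.ReflTransGen.refl
      · obtain ⟨nu, hcov, hle⟩ := exists_coveredBy_of_lt hlt
        exact (ih nu hcov.lt hle).tail hcov

end Covers

instance : OrderBot (NCP n) where
  bot := { arcs := ∅, lt_of_mem := by simp, noncrossing := by simp }
  bot_le _ t := Nat.zero_le _

end NCP

namespace ExcedanceQuotient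

open scoped Finset

open NCP Relation

variable {n : ℕ}

section Bruhat

/-- The inversion set of a permutation, whose cardinality is its length. -/
def inversions (w : Equiv.Perm (Fin n)) : Finset (Fin n × Fin n) :=
  {p | p.1 < p.2 ∧ w p.2 < w p.1}

/-- The action of a permutation `s` on the increasing pairs that stay increasing, extended by the
identity to the other pairs. It transports inversions when a permutation is composed with `s`. -/
def increasingPairMap {α : Type*} [LinearOrder α] (s : Equiv.Perm α) (p : α × α) : α × α :=
  if s p.1 < s p.2 then (s p.1, s p.2) else p

theorem increasingPairMap_leftInvOn {α : Type*} [LinearOrder α] {s : Equiv.Perm α}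
    (hs : Function.Involutive s) :
    Set.LeftInvOn (increasingPairMap s) (increasingPairMap s) {p | p.1 < p.2} := by
  intro p (hp : p.1 < p.2)
  grind [increasingPairMap, Function.Involutive]

variable {u v w : Equiv.Perm (Fin n)} {a b : Fin n}

theorem mem_inversions {p : Fin n × Fin n} : p ∈ inversions w ↔ p.1 < p.2 ∧ w p.2 < w p.1 := by
  rw [inversions, Finset.mem_filter_univ]

theorem increasingPairMap_mem_inversions (hu : u a < u b) (hab : a < b) {p : Fin n × Fin n}
    (hp : p ∈ inversions u) :
    increasingPairMap (Equiv.swap a b) p ∈ inversions (u * Equiv.swap a b) := by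
  rw [mem_inversions] at hp
  rw [increasingPairMap]
  split_ifs with h
  · simpa only [mem_inversions, Equiv.Perm.mul_apply, Equiv.swap_apply_self] using ⟨h, hp.2⟩
  · rw [mem_inversions, Equiv.Perm.mul_apply, Equiv.Perm.mul_apply]
    simp only [Equiv.swap_apply_def] at h ⊢
    grind

/-- Transporting the inversions of `u` misses the new inversion `(a, b)`. -/
theorem length_lt_length_mul_swap (hab : a < b) (hu : u a < u b) :
    length u < length (u * Equiv.swap a b) := by
  have hinv := increasingPairMap_leftInvOn (Equiv.swap_apply_self a b)
  have hsub : (inversions u : Set (Fin n × Fin n)) ⊆ {p | p.1 < p.2} := fun p hp =>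
    (mem_inversions.1 hp).1
  have hfix : increasingPairMap (Equiv.swap a b) (a, b) = (a, b) := by
    simp [increasingPairMap, hab.le]
  have hnew : (a, b) ∈ inversions (u * Equiv.swap a b) := by
    simp [mem_inversions, hab, hu]
  have hmaps : ∀ p ∈ inversions u, increasingPairMap (Equiv.swap a b) p ∈
      (inversions (u * Equiv.swap a b)).erase (a, b) := by
    refine fun p hp =>
      Finset.mem_erase.2 ⟨fun heq => ?_, increasingPairMap_mem_inversions hu hab hp⟩
    obtain rfl : p = (a, b) := by rw [← hinv (hsub hp), heq, hfix]
    exact hu.not_gt (mem_inversions.1 hp).2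
  calc length u ≤ #((inversions (u * Equiv.swap a b)).erase (a, b)) :=
        Finset.card_le_card_of_injOn _ hmaps (hinv.injOn.mono hsub)
    _ < length (u * Equiv.swap a b) := Finset.card_erase_lt_of_mem hnew

theorem bruhatStep_mul_swap (hab : a < b) (hu : u a < u b) :
    BruhatStep u (u * Equiv.swap a b) :=
  ⟨⟨u a, u b, hu.ne, by rw [Equiv.swap_apply_apply]⟩, length_lt_length_mul_swap hab hu⟩

theorem lt_of_length_lt_length_mul_swap (hab : a < b)
    (h : length u < length (u * Equiv.swap a b)) : u a < u b := by
  by_contra! hle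
  have hlt : u b < u a := hle.lt_of_ne (u.injective.ne hab.ne')
  have := length_lt_length_mul_swap (u := u * Equiv.swap a b) hab (by simpa using hlt)
  rw [mul_assoc, Equiv.swap_mul_self, mul_one] at this
  exact h.not_gt this

theorem BruhatStep.exists_eq_mul_swap (h : BruhatStep v w) :
    ∃ a b : Fin n, a < b ∧ v a < v b ∧ w = v * Equiv.swap a b := by
  obtain ⟨⟨x, y, hxy, hswap⟩, hlen⟩ := h
  have hw : w = v * Equiv.swap (v⁻¹ x) (v⁻¹ y) := by
    rw [Equiv.swap_apply_apply, ← hswap]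
    group
  rcases lt_or_gt_of_ne (v⁻¹.injective.ne hxy) with hlt | hlt
  · exact ⟨_, _, hlt, lt_of_length_lt_length_mul_swap hlt (hw ▸ hlen), hw⟩
  · rw [Equiv.swap_comm] at hw
    exact ⟨_, _, hlt, lt_of_length_lt_length_mul_swap hlt (hw ▸ hlen), hw⟩

end Bruhat

section DeficiencyArcs

variable {u v w : Equiv.Perm (Fin n)} {lam mu : NCP n}

/-- The arcs `(w r, r)` at the deficiencies `r` of `w`, the points with `w r < r`. -/
def deficiencyArcs (w : Equiv.Perm (Fin n)) : Finset (Fin n × Fin n) :=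
  ({r | w r < r} : Finset (Fin n)).image fun r => (w r, r)

theorem mem_deficiencyArcs {l r : Fin n} : (l, r) ∈ deficiencyArcs w ↔ w r = l ∧ l < r := by
  simp only [deficiencyArcs, Finset.mem_image, Finset.mem_filter, Finset.mem_univ, true_and,
    Prod.mk.injEq]
  grind

theorem isDiagram_deficiencyArcs (w : Equiv.Perm (Fin n)) : IsDiagram (deficiencyArcs w) where
  lt := fun ⟨_, _⟩ h => (mem_deficiencyArcs.1 h).2
  injOn_fst := by
    rintro ⟨l, r⟩ h ⟨l', r'⟩ h' rfl
    rw [Finset.mem_coe, mem_deficiencyArcs] at h h'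
    rw [w.injective (h.1.trans h'.1.symm)]
  injOn_snd := by
    rintro ⟨l, r⟩ h ⟨l', r'⟩ h' rfl
    rw [Finset.mem_coe, mem_deficiencyArcs] at h h'
    rw [← h.1, ← h'.1]

theorem excVal_eq_compl (w : Equiv.Perm (Fin n)) :
    excVal w = (↑((deficiencyArcs w).image Prod.fst))ᶜ := by
  ext x
  obtain ⟨i, rfl⟩ := w.surjective x
  simp [excVal, mem_deficiencyArcs]

theorem excPos_eq_compl (w : Equiv.Perm (Fin n)) :
    excPos w = (↑((deficiencyArcs w).image Prod.snd))ᶜ := by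
  ext i
  simp [excPos, mem_deficiencyArcs]

theorem mem_excClass_iff : w ∈ excClass lam ↔
    (deficiencyArcs w).image Prod.fst = lam.arcs.image Prod.fst ∧
      (deficiencyArcs w).image Prod.snd = lam.arcs.image Prod.snd := by
  rw [excClass, Set.mem_ofPred_eq, excVal_eq_compl, excPos_eq_compl, compl_inj_iff, compl_inj_iff,
    ← coe_image_fst_arcs, ← coe_image_snd_arcs, Finset.coe_inj, Finset.coe_inj]

theorem mem_excClass_of_deficiencyArcs_eq (h : deficiencyArcs w = lam.arcs) : w ∈ excClass lam :=
  mem_excClass_iff.2 (h ▸ ⟨rfl, rfl⟩)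

theorem excClass_eq_of_mem (hw : w ∈ excClass lam) :
    excClass lam = {v | (excSetoid n).r v w} :=
  Set.ext fun v => by
    change _ ↔ excVal v = excVal w ∧ excPos v = excPos w
    rw [hw.1, hw.2]
    rfl

theorem height_deficiencyArcs (w : Equiv.Perm (Fin n)) (t : ℕ) :
    height (deficiencyArcs w) t = #{r | 2 * (w r : ℕ) + 2 ≤ t ∧ t ≤ 2 * (r : ℕ)} := by
  rw [height, deficiencyArcs, Finset.filter_image, Finset.filter_filter,
    Finset.card_image_of_injective _ fun _ _ h => congrArg Prod.snd h]
  congr 1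
  ext r
  grind

theorem BruhatStep.height_le (h : BruhatStep v w) :
    height (deficiencyArcs v) ≤ height (deficiencyArcs w) := by
  intro t
  obtain ⟨a, b, hab, hv, rfl⟩ := h.exists_eq_mul_swap
  rw [height_deficiencyArcs, height_deficiencyArcs]
  by_cases ha : t ≤ 2 * (a : ℕ)
  · apply Finset.card_le_card_of_injOn (Equiv.swap a b) _ (Equiv.injective _).injOn
    intro r hr
    rw [Finset.mem_coe, Finset.mem_filter_univ] at hr ⊢
    rw [Equiv.Perm.mul_apply, Equiv.swap_apply_self, Equiv.swap_apply_def]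
    grind
  · refine Finset.card_le_card (Finset.monotone_filter_right _ fun r _ hr => ⟨?_, hr.2⟩)
    rw [Equiv.Perm.mul_apply, Equiv.swap_apply_def]
    grind

theorem BruhatLE.height_le (h : BruhatLE v w) :
    height (deficiencyArcs v) ≤ height (deficiencyArcs w) := by
  induction h with
  | refl => exact le_rfl
  | tail _ hstep ih => exact ih.trans hstep.height_le

theorem height_deficiencyArcs_of_mem (hw : w ∈ excClass lam) :
    height (deficiencyArcs w) = height lam.arcs :=
  (isDiagram_deficiencyArcs w).height_congr lam.isDiagram (mem_excClass_iff.1 hw).1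
    (mem_excClass_iff.1 hw).2

theorem le_of_classLE (h : ClassLE (excClass lam) (excClass mu)) : lam ≤ mu := by
  obtain ⟨v, hv, w, hw, hvw⟩ := h
  change height lam.arcs ≤ height mu.arcs
  rw [← height_deficiencyArcs_of_mem hv, ← height_deficiencyArcs_of_mem hw]
  exact hvw.height_le

theorem deficiencyArcs_mul_swap_eq_insert {i j : Fin n} (hi : i ≤ v i) (hij : v i < j)
    (hj : j ≤ v j) :
    deficiencyArcs (v * Equiv.swap i j) = insert (v i, j) (deficiencyArcs v) := by
  ext ⟨l, r⟩
  simp only [Finset.mem_insert, mem_deficiencyArcs, Equiv.Perm.mul_apply, Equiv.swap_apply_def,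
    Prod.mk.injEq]
  grind

theorem exists_bruhatStep_of_removesShortArc (hv : deficiencyArcs v = lam.arcs)
    (h : RemovesShortArc lam mu) : ∃ w, deficiencyArcs w = mu.arcs ∧ BruhatStep v w := by
  obtain ⟨i, j, hij, hmem, h⟩ := h
  have hsub : ∀ {l r}, v r = l → l < r → (l, r) ∈ mu.arcs.erase (i, j) := fun hr hlr =>
    h ▸ hv ▸ mem_deficiencyArcs.2 ⟨hr, hlr⟩
  obtain ⟨a, rfl⟩ := v.surjective i
  have ha : a ≤ v a := by
    by_contra! hlt
    obtain ⟨hne, ha_mem⟩ := Finset.mem_erase.1 (hsub rfl hlt)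
    exact hne (by rw [mu.isDiagram.right_unique ha_mem hmem])
  have hj : j ≤ v j := by
    by_contra! hlt
    obtain ⟨hne, hj_mem⟩ := Finset.mem_erase.1 (hsub rfl hlt)
    exact hne (by rw [mu.isDiagram.left_unique hj_mem hmem])
  refine ⟨v * Equiv.swap a j, ?_, bruhatStep_mul_swap (by grind) (by grind)⟩
  rw [deficiencyArcs_mul_swap_eq_insert ha (by grind) hj, hv, h, Finset.insert_erase hmem]

theorem exists_bruhatStep_of_splitsArc (hv : deficiencyArcs v = lam.arcs)
    (h : SplitsArc lam mu) : ∃ w, deficiencyArcs w = mu.arcs ∧ BruhatStep v w := by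
  obtain ⟨i, j, k, hij, hjk, hmem, h⟩ := h
  have hvj : v j = i := (mem_deficiencyArcs.1 (hv ▸ h ▸ by simp : (i, j) ∈ deficiencyArcs v)).1
  have hvk : v k = j := (mem_deficiencyArcs.1 (hv ▸ h ▸ by simp : (j, k) ∈ deficiencyArcs v)).1
  refine ⟨v * Equiv.swap j k, ?_, bruhatStep_mul_swap hjk (by rwa [hvj, hvk])⟩
  ext ⟨l, r⟩
  have hlam : (l, r) ∈ lam.arcs ↔ v r = l ∧ l < r := hv ▸ mem_deficiencyArcs
  have hleft := mu.isDiagram.left_unique (i := i) (j := l) hmem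
  have hright := mu.isDiagram.right_unique (i := i) (j := r) (k := k)
  simp only [h, Finset.mem_insert, Finset.mem_erase, Prod.mk.injEq] at hlam
  simp only [mem_deficiencyArcs, Equiv.Perm.mul_apply, Equiv.swap_apply_def]
  grind

theorem exists_bruhatLE_of_prec (hv : deficiencyArcs v = lam.arcs) (h : Prec lam mu) :
    ∃ w, deficiencyArcs w = mu.arcs ∧ BruhatLE v w := by
  induction h with
  | refl => exact ⟨v, hv, ReflTransGen.refl⟩
  | tail _ hcov ih =>
    obtain ⟨u, hu, hvu⟩ := ih
    obtain ⟨w, hw, huw⟩ := hcov.elim (exists_bruhatStep_of_removesShortArc hu)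
      (exists_bruhatStep_of_splitsArc hu)
    exact ⟨w, hw, hvu.tail huw⟩

theorem exists_deficiencyArcs_eq (lam : NCP n) : ∃ w, deficiencyArcs w = lam.arcs := by
  have hone : deficiencyArcs (1 : Equiv.Perm (Fin n)) = (⊥ : NCP n).arcs := by
    simp [deficiencyArcs, Bot.bot]
  obtain ⟨w, hw, -⟩ := exists_bruhatLE_of_prec hone (prec_iff_le.2 (bot_le (a := lam)))
  exact ⟨w, hw⟩

theorem classLE_excClass_iff_le : ClassLE (excClass lam) (excClass mu) ↔ lam ≤ mu := by
  refine ⟨le_of_classLE, fun h => ?_⟩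
  obtain ⟨v, hv⟩ := exists_deficiencyArcs_eq lam
  obtain ⟨w, hw, hvw⟩ := exists_bruhatLE_of_prec hv (prec_iff_le.2 h)
  exact ⟨v, mem_excClass_of_deficiencyArcs_eq hv, w, mem_excClass_of_deficiencyArcs_eq hw, hvw⟩

end DeficiencyArcs

section Classes

variable {w : Equiv.Perm (Fin n)}

theorem excSetoid_mul_swap {i j : Fin n} (hij : w i < w j) (hji : w j < i) (hlt : i < j) :
    (excSetoid n).r (w * Equiv.swap i j) w := by
  have hpos : ∀ p, p ≤ (w * Equiv.swap i j) p ↔ p ≤ w p := by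
    intro p
    rw [Equiv.Perm.mul_apply, Equiv.swap_apply_def]
    grind
  have happly : ∀ p, p ≤ w p → (w * Equiv.swap i j) p = w p := by
    intro p hp
    rw [Equiv.Perm.mul_apply, Equiv.swap_apply_of_ne_of_ne] <;> grind
  exact ⟨Set.ext fun x => exists_congr fun p => by grind, Set.ext hpos⟩

/-- If the arcs of `w` at `i < j` crossed, exchanging the values of `w` at `i` and `j` would give a
longer permutation in the same class. -/
theorem not_crosses_of_length_maximal
    (hmax : ∀ v, (excSetoid n).r v w → length v ≤ length w) :
    (deficiencyArcs w : Set (Fin n × Fin n)).Pairwise fun a b => ¬ Crosses a b := by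
  rintro ⟨x, i⟩ hi ⟨y, j⟩ hj hne ⟨hle, hji, hij⟩
  obtain ⟨rfl, -⟩ := mem_deficiencyArcs.1 hi
  obtain ⟨rfl, -⟩ := mem_deficiencyArcs.1 hj
  have hij_lt : i < j := lt_of_le_of_ne hij (by grind)
  have hw : w i < w j := lt_of_le_of_ne hle (w.injective.ne hij_lt.ne)
  exact (hmax _ (excSetoid_mul_swap hw hji hij_lt)).not_gt (length_lt_length_mul_swap hij_lt hw)

theorem exists_mem_excClass (u : Equiv.Perm (Fin n)) : ∃ lam : NCP n, u ∈ excClass lam := by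
  obtain ⟨w, hwu, hmax⟩ := Set.exists_max_image {x | (excSetoid n).r x u} length (Set.toFinite _)
    ⟨u, (excSetoid n).refl u⟩
  have hnc := not_crosses_of_length_maximal fun v hv => hmax v ((excSetoid n).trans hv hwu)
  let lam : NCP n := ⟨deficiencyArcs w, (isDiagram_deficiencyArcs w).lt,
    fun a ha b hb => hnc ha hb⟩
  have hw : w ∈ excClass lam := mem_excClass_of_deficiencyArcs_eq rfl
  exact ⟨lam, hwu.1.symm.trans hw.1, hwu.2.symm.trans hw.2⟩

theorem excClass_injective : Function.Injective (excClass : NCP n → Set (Equiv.Perm (Fin n))) := by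
  intro lam mu h
  obtain ⟨w, hw⟩ := exists_deficiencyArcs_eq lam
  have hlam := mem_excClass_of_deficiencyArcs_eq hw
  have hmu := h ▸ hlam
  exact height_arcs_injective
    ((height_deficiencyArcs_of_mem hlam).symm.trans (height_deficiencyArcs_of_mem hmu))

theorem bijOn_excClass :
    Set.BijOn (excClass : NCP n → Set (Equiv.Perm (Fin n))) Set.univ (excSetoid n).classes := by
  refine ⟨fun lam _ => ?_, excClass_injective.injOn, ?_⟩
  · obtain ⟨w, hw⟩ := exists_deficiencyArcs_eq lam
    exact ⟨w, excClass_eq_of_mem (mem_excClass_of_deficiencyArcs_eq hw)⟩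
  · rintro - ⟨u, rfl⟩
    obtain ⟨lam, hu⟩ := exists_mem_excClass u
    exact ⟨lam, trivial, excClass_eq_of_mem hu⟩

/-- The parametrization of the excedance classes by noncrossing partitions, as an isomorphism from
the order by lattice paths to the relation induced by the Bruhat order. It carries the partial
order axioms over to the classes. -/
noncomputable def excClassRelIso (n : ℕ) :
    ((· ≤ ·) : NCP n → NCP n → Prop) ≃r
      fun A B : (excSetoid n).classes => ClassLE A.1 B.1 where
  toEquiv := (Equiv.Set.univ _).symm.trans bijOn_excClass.equiv
  map_rel_iff' := classLE_excClass_iff_le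

end Classes

end ExcedanceQuotient

open ExcedanceQuotient in
theorem mainTheorem1 (n : ℕ) :
    -- the excedance classes are indexed bijectively by the noncrossing partitions
    Set.BijOn (excClass : NCP n → Set (Equiv.Perm (Fin n))) Set.univ (excSetoid n).classes ∧
    -- the induced relation on the classes is the order on noncrossing partitions
    (∀ lam mu : NCP n, ClassLE (excClass lam) (excClass mu) ↔ NCP.Prec lam mu) ∧
    -- the induced relation is a partial order on the set of excedance classes
    IsPartialOrder (excSetoid n).classes (fun A B => ClassLE A.1 B.1) :=
  ⟨bijOn_excClass, fun _ _ => classLE_excClass_iff_le.trans NCP.prec_iff_le.symm,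
    (excClassRelIso n).symm.toRelEmbedding.isPartialOrder⟩
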